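/- Let $m\ge 1$ be an integer and let $a,b,c$ be real numbers with $a,b,c>(m-1)/2$. For a symmetric $m\times m$ matrix $X=(x_{ij})$ write $(dX)=\bigwedge_{i\le j}dx_{ij}$ for Lebesgue measure in the $m(m+1)/2$ entries on and above the diagonal, $|X|$ for the determinant, $\operatorname{etr}(X)=\exp(\operatorname{tr}X)$, and $X>0$ if $X$ is symmetric positive definite. Put $$\Gamma_m[a]=\int_{V>0}\operatorname{etr}(-V)\,|V|^{a-(m+1)/2}(dV),\qquad \beta^*_m[a,b,c]=\frac{\Gamma_m[a]\,\Gamma_m[b]\,\Gamma_m[c]}{\Gamma_m[a+b+c]} .$$ For a positive definite $m\times m$ matrix $\Theta$, the matrix variate gamma distribution $\mathcal G_m(a,\Theta)$ is the law of a random symmetric matrix with density $$\frac{1}{\Gamma_m[a]\,|\Theta|^{a}}\,|X|^{a-(m+1)/2}\operatorname{etr}(-\Theta^{-1}X),\qquad X>0,$$ with respect to $(dX)$. **Theorem (bimatrix variate generalised beta type II density).** Let $A\sim\mathcal G_m(a,I_m)$, $B\sim\mathcal G_m(b,I_m)$ and $C\sim\mathcal G_m(c,I_m)$ be independent random matrices,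 and set $$F_1=C^{-1/2}AC^{-1/2},\qquad F_2=C^{-1/2}BC^{-1/2},$$ where $C^{-1/2}$ is the inverse of the positive definite symmetric square root of $C$ (which is positive definite almost surely). Then $(F_1,F_2)$ has the joint density $$\frac{|F_1|^{a-(m+1)/2}\,|F_2|^{b-(m+1)/2}}{\beta^*_m[a,b,c]\;|I_m+F_1+F_2|^{a+b+c}},\qquad F_1>0,\ F_2>0,$$ with respect to the product measure $(dF_1)(dF_2)$; that is, the law of $(F_1,F_2)$ is the measure with this density on $\{F_1>0,\ F_2>0\}$ and density $0$ elsewhere. -/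

import Mathlib

open scoped MatrixOrder

/-- The product (equivalently, Borel) `σ`-algebra on real `m × m` matrices. -/
instance matrixMeasurableSpace (m : ℕ) : MeasurableSpace (Matrix (Fin m) (Fin m) ℝ) :=
  inferInstanceAs (MeasurableSpace (Fin m → Fin m → ℝ))

instance matrixBorelSpace (m : ℕ) : BorelSpace (Matrix (Fin m) (Fin m) ℝ) :=
  inferInstanceAs (BorelSpace (Fin m → Fin m → ℝ))

/-- The symmetric `m × m` matrix whose entries on and above the diagonal are the coordinates
`x (i, j)`, `i ≤ j`. -/
def symmOfUpper (m : ℕ) (x : {p : Fin m × Fin m // p.1 ≤ p.2} → ℝ) :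
    Matrix (Fin m) (Fin m) ℝ :=
  Matrix.of fun i j => x ⟨(min i j, max i j), min_le_max⟩

/-- The measure `(dX) = ⋀_{i ≤ j} dx_{ij}`: Lebesgue measure in the coordinates `x_{ij}`, `i ≤ j`,
of a symmetric matrix, as a measure on all `m × m` matrices (carried by the symmetric ones). -/
noncomputable def symmLebesgue (m : ℕ) : MeasureTheory.Measure (Matrix (Fin m) (Fin m) ℝ) :=
  (MeasureTheory.volume : MeasureTheory.Measure ({p : Fin m × Fin m // p.1 ≤ p.2} → ℝ)).map
    (symmOfUpper m)

theorem measurable_symmOfUpper (m : ℕ) : Measurable (symmOfUpper m) :=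
  measurable_pi_iff.2 fun _ => measurable_pi_iff.2 fun _ => measurable_pi_apply _

/-- The multivariate gamma function `Γ_m[a] = ∫_{V > 0} etr(-V) |V|^{a - (m+1)/2} (dV)`. -/
noncomputable def multiGamma (m : ℕ) (a : ℝ) : ℝ :=
  ∫ V in {V : Matrix (Fin m) (Fin m) ℝ | V.PosDef},
    Real.exp (-V.trace) * V.det ^ (a - ((m : ℝ) + 1) / 2) ∂(symmLebesgue m)

/-- `β*_m[a,b,c] = Γ_m[a] Γ_m[b] Γ_m[c] / Γ_m[a+b+c]`. -/
noncomputable def multiBetaStar (m : ℕ) (a b c : ℝ) : ℝ :=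
  multiGamma m a * multiGamma m b * multiGamma m c / multiGamma m (a + b + c)

/-- The density, with respect to `symmLebesgue m`, of the matrix variate gamma distribution
`G_m(a, Θ)`. -/
noncomputable def matrixGammaDensity (m : ℕ) (a : ℝ) (Θ : Matrix (Fin m) (Fin m) ℝ) :
    Matrix (Fin m) (Fin m) ℝ → ℝ :=
  Set.indicator {X | X.PosDef} fun X =>
    1 / (multiGamma m a * Θ.det ^ a) * X.det ^ (a - ((m : ℝ) + 1) / 2) *
      Real.exp (-(Θ⁻¹ * X).trace)

/-- The matrix variate gamma distribution `G_m(a, Θ)`. -/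
noncomputable def matrixGammaMeasure (m : ℕ) (a : ℝ) (Θ : Matrix (Fin m) (Fin m) ℝ) :
    MeasureTheory.Measure (Matrix (Fin m) (Fin m) ℝ) :=
  (symmLebesgue m).withDensity fun X => ENNReal.ofReal (matrixGammaDensity m a Θ X)

/-- `C^{-1/2}`, the inverse of the positive semidefinite square root of `C`. -/
noncomputable def invSqrt {m : ℕ} (C : Matrix (Fin m) (Fin m) ℝ) : Matrix (Fin m) (Fin m) ℝ :=
  (CFC.sqrt C)⁻¹

/-- The density, with respect to `(dF₁) ∧ (dF₂)`, of the bimatrix variate generalised beta type II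
distribution:
`|F₁|^{a-(m+1)/2} |F₂|^{b-(m+1)/2} / (β*_m[a,b,c] |I + F₁ + F₂|^{a+b+c})` on `F₁ > 0`, `F₂ > 0`. -/
noncomputable def bimatrixBetaIIDensity (m : ℕ) (a b c : ℝ) :
    Matrix (Fin m) (Fin m) ℝ × Matrix (Fin m) (Fin m) ℝ → ℝ :=
  Set.indicator {F | F.1.PosDef ∧ F.2.PosDef} fun F =>
    F.1.det ^ (a - ((m : ℝ) + 1) / 2) * F.2.det ^ (b - ((m : ℝ) + 1) / 2) /
      (multiBetaStar m a b c * (1 + F.1 + F.2).det ^ (a + b + c))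

open MeasureTheory Matrix
open scoped ENNReal

/-! Condition on C and substitute A = C^{1/2} F₁ C^{1/2}, B = C^{1/2} F₂ C^{1/2}. Each substitution
has Jacobian |C|^{(m+1)/2}, so the joint density of (F₁, F₂, C) is, up to the gamma constants, a
product of powers of |F₁|, |F₂| and |C| times etr(-(I + F₁ + F₂)C), by cyclicity of the trace. As a
function of C this is a gamma kernel with exponent parameter a + b + c; integrating C out gives
Γ_m[a+b+c] |I + F₁ + F₂|^{-(a+b+c)}.

Three facts carry this: the Jacobian of a symmetric congruence (`det_upperCongr`), the scaling law
of the gamma integral (`lintegral_gammaKernel`), and the exchange of integrals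
(`lintegral_beta_of_gamma`). Integrals against arbitrary measurable test functions take values in
`ℝ≥0∞`, so Tonelli needs no convergence hypothesis. Finiteness of Γ_m[a+b+c] is read off at the end
from total mass one. -/

instance matrixPolishSpace (m : ℕ) : PolishSpace (Matrix (Fin m) (Fin m) ℝ) :=
  inferInstanceAs (PolishSpace (Fin m → Fin m → ℝ))

instance symmLebesgue_sFinite (m : ℕ) : SFinite (symmLebesgue m) := by
  unfold symmLebesgue; infer_instance

/-! ### Congruences of symmetric matrices and their Jacobian -/

theorem symmOfUpper_isSymm (m : ℕ) (x : {p : Fin m × Fin m // p.1 ≤ p.2} → ℝ) :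
    (symmOfUpper m x).IsSymm := by
  ext i j
  simp [symmOfUpper, min_comm, max_comm]

theorem symmOfUpper_apply_of_le {m : ℕ} {M : Matrix (Fin m) (Fin m) ℝ} (hM : M.IsSymm) :
    symmOfUpper m (fun p => M p.1.1 p.1.2) = M := by
  ext i j
  rcases le_total i j with h | h
  · simp [symmOfUpper, h]
  · simpa [symmOfUpper, h] using hM.apply i j

/-- The congruence `X ↦ T X Tᵀ` of symmetric matrices, in the coordinates on and above the
diagonal. -/
def upperCongr {m : ℕ} (T : Matrix (Fin m) (Fin m) ℝ) :
    ({p : Fin m × Fin m // p.1 ≤ p.2} → ℝ) →ₗ[ℝ] ({p : Fin m × Fin m // p.1 ≤ p.2} → ℝ) where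
  toFun x := fun p => (T * symmOfUpper m x * Tᵀ) p.1.1 p.1.2
  map_add' x y := by
    have : symmOfUpper m (x + y) = symmOfUpper m x + symmOfUpper m y := by
      ext i j; simp [symmOfUpper]
    ext p; simp [this, Matrix.mul_add, Matrix.add_mul]
  map_smul' c x := by
    have : symmOfUpper m (c • x) = c • symmOfUpper m x := by
      ext i j; simp [symmOfUpper]
    ext p; simp [this]

theorem symmOfUpper_upperCongr {m : ℕ} (T : Matrix (Fin m) (Fin m) ℝ)
    (x : {p : Fin m × Fin m // p.1 ≤ p.2} → ℝ) :
    symmOfUpper m (upperCongr T x) = T * symmOfUpper m x * Tᵀ := by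
  refine symmOfUpper_apply_of_le (M := T * symmOfUpper m x * Tᵀ) ?_
  simp [Matrix.IsSymm, Matrix.transpose_mul, (symmOfUpper_isSymm m x).eq, Matrix.mul_assoc]

theorem upperCongr_mul {m : ℕ} (S T : Matrix (Fin m) (Fin m) ℝ) :
    upperCongr (S * T) = upperCongr S ∘ₗ upperCongr T := by
  refine LinearMap.ext fun x => funext fun p => ?_
  change (S * T * symmOfUpper m x * (S * T)ᵀ) p.1.1 p.1.2 =
    (S * symmOfUpper m (upperCongr T x) * Sᵀ) p.1.1 p.1.2
  rw [symmOfUpper_upperCongr, Matrix.transpose_mul]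
  simp only [Matrix.mul_assoc]

theorem symmOfUpper_apply_coe {m : ℕ} (x : {p : Fin m × Fin m // p.1 ≤ p.2} → ℝ)
    (p : {p : Fin m × Fin m // p.1 ≤ p.2}) : symmOfUpper m x p.1.1 p.1.2 = x p := by
  simp [symmOfUpper, p.2]

theorem upperCongr_diagonal {m : ℕ} (d : Fin m → ℝ) :
    upperCongr (diagonal d) =
      Matrix.toLin' (diagonal fun p : {p : Fin m × Fin m // p.1 ≤ p.2} => d p.1.1 * d p.1.2) := by
  refine LinearMap.ext fun x => funext fun p => ?_
  change (diagonal d * symmOfUpper m x * (diagonal d)ᵀ) p.1.1 p.1.2 = _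
  simp [Matrix.mulVec_diagonal, symmOfUpper_apply_coe]
  ring

/-- Each index i lies in m - 1 off-diagonal pairs and twice in the pair (i, i), hence the exponent m
+ 1. The proof swaps the indices in the second factor, so that d i meets every j once and j = i a
second time. -/
theorem prod_upper_mul {m : ℕ} (d : Fin m → ℝ) :
    ∏ p : {p : Fin m × Fin m // p.1 ≤ p.2}, d p.1.1 * d p.1.2 = (∏ i, d i) ^ (m + 1) := by
  have h1 : ∏ p : {p : Fin m × Fin m // p.1 ≤ p.2}, d p.1.1 * d p.1.2 =
      ∏ i, ∏ j, if i ≤ j then d i * d j else 1 := by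
    rw [← Fintype.prod_prod_type' (f := fun i j => if i ≤ j then d i * d j else 1),
      ← Finset.prod_filter]
    exact (Finset.prod_subtype _ (by simp) fun p : Fin m × Fin m => d p.1 * d p.2).symm
  have h2 : ∀ i j, (if i ≤ j then d i * d j else 1) =
      (if i ≤ j then d i else 1) * (if i ≤ j then d j else 1) := by
    intro i j; split_ifs <;> simp
  have h3 : ∀ i j, (if i ≤ j then d i else 1) * (if j ≤ i then d i else 1) =
      d i * (if i = j then d i else 1) := by
    intro i j
    rcases lt_trichotomy i j with h | h | h
    · simp [h.le, h.not_ge, h.ne]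
    · simp [h]
    · simp [h.le, h.not_ge, h.ne']
  rw [h1]
  simp only [h2, Finset.prod_mul_distrib]
  rw [Finset.prod_comm (f := fun i j => if i ≤ j then d j else 1)]
  simp only [← Finset.prod_mul_distrib, h3]
  simp only [Finset.prod_mul_distrib, Finset.prod_ite_eq, Finset.mem_univ, if_true,
    Finset.prod_const, Finset.card_univ, Fintype.card_fin]
  rw [Finset.prod_pow, pow_succ]

theorem det_upperCongr_diagonal {m : ℕ} (d : Fin m → ℝ) :
    LinearMap.det (upperCongr (diagonal d)) = (diagonal d).det ^ (m + 1) := by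
  rw [upperCongr_diagonal, LinearMap.det_toLin', det_diagonal, det_diagonal, prod_upper_mul]

theorem upperCongr_one (m : ℕ) : upperCongr (1 : Matrix (Fin m) (Fin m) ℝ) = LinearMap.id := by
  refine LinearMap.ext fun x => funext fun p => ?_
  change ((1 : Matrix (Fin m) (Fin m) ℝ) * symmOfUpper m x * (1 : Matrix (Fin m) (Fin m) ℝ)ᵀ)
    p.1.1 p.1.2 = _
  simp [symmOfUpper_apply_coe]

/-- The Jacobian of the congruence `X ↦ T X Tᵀ` on symmetric matrices. -/
theorem det_upperCongr {m : ℕ} {T : Matrix (Fin m) (Fin m) ℝ} (hT : T.IsHermitian) :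
    LinearMap.det (upperCongr T) = T.det ^ (m + 1) := by
  have h := hT.spectral_theorem
  rw [Unitary.conjStarAlgAut_apply] at h
  set U : Matrix (Fin m) (Fin m) ℝ := (hT.eigenvectorUnitary : Matrix (Fin m) (Fin m) ℝ)
  have hU : U * star U = 1 := Unitary.coe_mul_star_self _
  set D := diagonal (RCLike.ofReal ∘ hT.eigenvalues : Fin m → ℝ)
  -- The determinant of the congruence by U alone is not needed: the factors of U and its inverse
  -- `star U` cancel, leaving the diagonal case.
  have h1 : LinearMap.det (upperCongr U) * LinearMap.det (upperCongr (star U)) = 1 := by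
    rw [← LinearMap.det_comp, ← upperCongr_mul, hU, upperCongr_one, LinearMap.det_id]
  have h2 : U.det * (star U).det = 1 := by rw [← det_mul, hU, det_one]
  rw [h, upperCongr_mul, upperCongr_mul, LinearMap.det_comp, LinearMap.det_comp,
    det_upperCongr_diagonal, det_mul, det_mul]
  calc _ = (LinearMap.det (upperCongr U) * LinearMap.det (upperCongr (star U))) *
        D.det ^ (m + 1) := by ring
    _ = ((U.det * (star U).det) * D.det) ^ (m + 1) := by rw [h1, h2, one_mul, one_mul]
    _ = _ := by ring

theorem measurable_congr {m : ℕ} (T S : Matrix (Fin m) (Fin m) ℝ) :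
    Measurable fun X : Matrix (Fin m) (Fin m) ℝ => T * X * S :=
  Continuous.measurable (by fun_prop)

theorem map_congr_symmLebesgue {m : ℕ} {T : Matrix (Fin m) (Fin m) ℝ} (hT : T.PosDef) :
    (symmLebesgue m).map (fun X => T * X * T) =
      ENNReal.ofReal ((T.det ^ (m + 1))⁻¹) • symmLebesgue m := by
  have hdet := det_upperCongr hT.isHermitian
  have hpos : 0 < T.det ^ (m + 1) := pow_pos hT.det_pos _
  have hTT : Tᵀ = T := by simpa using hT.isHermitian.eq
  have hlin := Real.map_linearMap_volume_pi_eq_smul_volume_pi (f := upperCongr T)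
    (by rw [hdet]; exact hpos.ne')
  have hmeas : Measurable (upperCongr T) :=
    (LinearMap.continuous_of_finiteDimensional _).measurable
  have hcomp : (fun X => T * X * T) ∘ symmOfUpper m = symmOfUpper m ∘ upperCongr T := by
    funext x; simp [symmOfUpper_upperCongr, hTT]
  rw [symmLebesgue, Measure.map_map (measurable_congr T T) (measurable_symmOfUpper m), hcomp,
    ← Measure.map_map (measurable_symmOfUpper m) hmeas, hlin, Measure.map_smul, hdet,
    abs_of_pos (inv_pos.2 hpos)]

/-! ### Measurability of the cone and of the inverse square root -/

theorem isClosed_setOf_matrix_nonneg (m : ℕ) : IsClosed {X : Matrix (Fin m) (Fin m) ℝ | 0 ≤ X} := by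
  have : {X : Matrix (Fin m) (Fin m) ℝ | 0 ≤ X} =
      {X | Xᴴ = X} ∩ ⋂ v : Fin m → ℝ, {X | 0 ≤ star v ⬝ᵥ (X *ᵥ v)} := by
    ext X
    simp [Matrix.nonneg_iff_posSemidef, posSemidef_iff_dotProduct_mulVec, Matrix.IsHermitian]
  rw [this]
  refine (isClosed_eq (by fun_prop) continuous_id).inter (isClosed_iInter fun v => ?_)
  exact isClosed_le continuous_const (by fun_prop)

theorem measurableSet_setOf_posDef (m : ℕ) :
    MeasurableSet {X : Matrix (Fin m) (Fin m) ℝ | X.PosDef} := by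
  have : {X : Matrix (Fin m) (Fin m) ℝ | X.PosDef} = {X | 0 ≤ X} ∩ {X | X.det ≠ 0} := by
    ext X
    refine ⟨fun h => ⟨h.posSemidef.nonneg, h.det_pos.ne'⟩, fun h => ?_⟩
    exact (Matrix.nonneg_iff_posSemidef.1 h.1).posDef_iff_det_ne_zero.2 h.2
  rw [this]
  exact (isClosed_setOf_matrix_nonneg m).measurableSet.inter
    (isOpen_ne_fun (by fun_prop) continuous_const).measurableSet

/-- On the closed cone the square root inverts the continuous injective map X ↦ X * X, and by
Lusin–Souslin such a map on a Polish space sends Borel sets to Borel sets. -/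
theorem measurable_cfcSqrt (m : ℕ) :
    Measurable (CFC.sqrt : Matrix (Fin m) (Fin m) ℝ → Matrix (Fin m) (Fin m) ℝ) := by
  have hP := (isClosed_setOf_matrix_nonneg m).measurableSet
  have hinj : Set.InjOn (fun X : Matrix (Fin m) (Fin m) ℝ => X * X) {X | 0 ≤ X} := by
    intro X hX Y hY h
    rw [← CFC.sqrt_mul_self X hX, ← CFC.sqrt_mul_self Y hY]
    exact congrArg _ h
  intro s hs
  have himg : MeasurableSet ((fun X : Matrix (Fin m) (Fin m) ℝ => X * X) '' (s ∩ {X | 0 ≤ X})) :=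
    (hs.inter hP).image_of_continuousOn_injOn (by fun_prop) (hinj.mono Set.inter_subset_right)
  have : (CFC.sqrt : Matrix (Fin m) (Fin m) ℝ → _) ⁻¹' s =
      ((fun X : Matrix (Fin m) (Fin m) ℝ => X * X) '' (s ∩ {X | 0 ≤ X})) ∪
        ({X | 0 ≤ X}ᶜ ∩ {_X | (0 : Matrix (Fin m) (Fin m) ℝ) ∈ s}) := by
    ext X
    by_cases hX : 0 ≤ X
    · simp only [Set.mem_preimage, Set.mem_union, Set.mem_image, Set.mem_inter_iff,
        Set.mem_compl_iff, Set.mem_ofPred_eq, hX, not_true_eq_false, false_and, or_false]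
      constructor
      · exact fun h => ⟨_, ⟨h, CFC.sqrt_nonneg X⟩, CFC.sqrt_mul_sqrt_self X hX⟩
      · rintro ⟨Y, ⟨hY, hY0⟩, rfl⟩
        rwa [CFC.sqrt_mul_self Y hY0]
    -- Off the cone `CFC.sqrt` has the default value 0, and no square of a nonnegative Y lies there.
    · simp only [Set.mem_preimage, CFC.sqrt_of_not_nonneg hX, Set.mem_union, Set.mem_image,
        Set.mem_inter_iff, Set.mem_compl_iff, Set.mem_ofPred_eq, hX, not_false_eq_true, true_and]
      constructor
      · exact Or.inr
      · rintro (⟨Y, ⟨-, hY0⟩, rfl⟩ | h)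
        · have hYY := star_mul_self_nonneg Y
          rw [(IsSelfAdjoint.of_nonneg hY0).star_eq] at hYY
          exact absurd hYY hX
        · exact h
  rw [this]
  exact himg.union (hP.compl.inter (MeasurableSet.const _))

theorem measurable_invSqrt (m : ℕ) :
    Measurable (invSqrt : Matrix (Fin m) (Fin m) ℝ → Matrix (Fin m) (Fin m) ℝ) := by
  have hinv : Measurable fun X : Matrix (Fin m) (Fin m) ℝ => X⁻¹ := by
    simp only [Matrix.inv_def, Ring.inverse_eq_inv']
    have h1 : Measurable fun X : Matrix (Fin m) (Fin m) ℝ => X.det⁻¹ :=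
      (Continuous.measurable (by fun_prop)).inv
    have h2 : Continuous fun X : Matrix (Fin m) (Fin m) ℝ => X.adjugate := by fun_prop
    refine measurable_pi_iff.2 fun i => measurable_pi_iff.2 fun j => ?_
    exact h1.mul (Continuous.measurable (by fun_prop))
  exact hinv.comp (measurable_cfcSqrt m)

/-! ### The gamma kernel and its scaling -/

/-- The unnormalised matrix variate gamma density `|X|^{s - (m+1)/2} etr(-S X)` on `X > 0`. -/
noncomputable def gammaKernel {m : ℕ} (s : ℝ) (S X : Matrix (Fin m) (Fin m) ℝ) : ℝ≥0∞ :=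
  Set.indicator {X | X.PosDef} (fun X => ENNReal.ofReal
    (X.det ^ (s - ((m : ℝ) + 1) / 2) * Real.exp (-(S * X).trace))) X

theorem gammaKernel_of_posDef {m : ℕ} (s : ℝ) (S : Matrix (Fin m) (Fin m) ℝ)
    {X : Matrix (Fin m) (Fin m) ℝ} (hX : X.PosDef) :
    gammaKernel s S X =
      ENNReal.ofReal (X.det ^ (s - ((m : ℝ) + 1) / 2) * Real.exp (-(S * X).trace)) :=
  Set.indicator_of_mem (s := {X : Matrix (Fin m) (Fin m) ℝ | X.PosDef}) hX _

theorem gammaKernel_of_not_posDef {m : ℕ} (s : ℝ) (S : Matrix (Fin m) (Fin m) ℝ)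
    {X : Matrix (Fin m) (Fin m) ℝ} (hX : ¬ X.PosDef) : gammaKernel s S X = 0 :=
  Set.indicator_of_notMem (s := {X : Matrix (Fin m) (Fin m) ℝ | X.PosDef}) hX _

theorem measurable_gammaKernel {m : ℕ} (s : ℝ) :
    Measurable fun p : Matrix (Fin m) (Fin m) ℝ × Matrix (Fin m) (Fin m) ℝ =>
      gammaKernel s p.1 p.2 := by
  have hdet : Measurable fun p : Matrix (Fin m) (Fin m) ℝ × Matrix (Fin m) (Fin m) ℝ => p.2.det :=
    Continuous.measurable (by fun_prop)
  have hexp : Measurable fun p : Matrix (Fin m) (Fin m) ℝ × Matrix (Fin m) (Fin m) ℝ =>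
      Real.exp (-(p.1 * p.2).trace) := Continuous.measurable (by fun_prop)
  exact ((hdet.pow_const _).mul hexp).ennreal_ofReal.indicator
    (measurable_snd (measurableSet_setOf_posDef m))

theorem measurable_gammaKernel_comp {m : ℕ} {α : Type*} [MeasurableSpace α] (s : ℝ)
    {f g : α → Matrix (Fin m) (Fin m) ℝ} (hf : Measurable f) (hg : Measurable g) :
    Measurable fun x => gammaKernel s (f x) (g x) := by
  have h := Measurable.comp (measurable_gammaKernel (m := m) s) (hf.prodMk hg)
  exact h

theorem gammaKernel_add {m : ℕ} (s : ℝ) (S T X : Matrix (Fin m) (Fin m) ℝ) :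
    gammaKernel s (S + T) X = gammaKernel s S X * ENNReal.ofReal (Real.exp (-(T * X).trace)) := by
  by_cases hX : X.PosDef
  · have := (Real.rpow_pos_of_pos hX.det_pos (s - ((m : ℝ) + 1) / 2)).le
    rw [gammaKernel_of_posDef s _ hX, gammaKernel_of_posDef s _ hX,
      ← ENNReal.ofReal_mul (by positivity), Matrix.add_mul, trace_add, neg_add, Real.exp_add,
      mul_assoc]
  · simp [gammaKernel_of_not_posDef s _ hX]

theorem gammaKernel_mul_det_rpow {m : ℕ} (s t : ℝ) (S X : Matrix (Fin m) (Fin m) ℝ) :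
    gammaKernel s S X * ENNReal.ofReal (X.det ^ t) = gammaKernel (s + t) S X := by
  by_cases hX : X.PosDef
  · have := (Real.rpow_pos_of_pos hX.det_pos (s - ((m : ℝ) + 1) / 2)).le
    rw [gammaKernel_of_posDef s _ hX, gammaKernel_of_posDef _ _ hX,
      ← ENNReal.ofReal_mul (by positivity),
      show s + t - ((m : ℝ) + 1) / 2 = (s - ((m : ℝ) + 1) / 2) + t by ring,
      Real.rpow_add hX.det_pos]
    ring_nf
  · simp [gammaKernel_of_not_posDef _ _ hX]

theorem posDef_cfcSqrt {m : ℕ} {S : Matrix (Fin m) (Fin m) ℝ} (hS : S.PosDef) :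
    (CFC.sqrt S).PosDef :=
  (IsStrictlyPositive.sqrt S hS.isStrictlyPositive).posDef

theorem cfcSqrt_mul_cfcSqrt {m : ℕ} {S : Matrix (Fin m) (Fin m) ℝ} (hS : S.PosDef) :
    CFC.sqrt S * CFC.sqrt S = S :=
  CFC.sqrt_mul_sqrt_self S hS.posSemidef.nonneg

theorem det_cfcSqrt_pow {m : ℕ} {S : Matrix (Fin m) (Fin m) ℝ} (hS : S.PosDef) (n : ℕ) :
    (CFC.sqrt S).det ^ n = S.det ^ ((n : ℝ) / 2) := by
  have h0 := (posDef_cfcSqrt hS).det_pos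
  conv_rhs => rw [← cfcSqrt_mul_cfcSqrt hS, det_mul, ← pow_two, ← Real.rpow_natCast,
    ← Real.rpow_mul h0.le]
  rw [← Real.rpow_natCast]
  congr 1
  push_cast
  ring

theorem gammaKernel_congr_cfcSqrt {m : ℕ} (s : ℝ) {S : Matrix (Fin m) (Fin m) ℝ} (hS : S.PosDef)
    (X : Matrix (Fin m) (Fin m) ℝ) :
    gammaKernel s 1 (CFC.sqrt S * X * CFC.sqrt S) =
      ENNReal.ofReal (S.det ^ (s - ((m : ℝ) + 1) / 2)) * gammaKernel s S X := by
  have hR := posDef_cfcSqrt hS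
  have hiff : (CFC.sqrt S * X * CFC.sqrt S).PosDef ↔ X.PosDef := by
    have := hR.isUnit.posDef_star_right_conjugate_iff (x := X)
    rwa [(show star (CFC.sqrt S) = CFC.sqrt S from hR.isHermitian.eq)] at this
  by_cases hX : X.PosDef
  · have h1 : (CFC.sqrt S * X * CFC.sqrt S).det = S.det * X.det := by
      conv_rhs => rw [← cfcSqrt_mul_cfcSqrt hS]
      simp only [det_mul]; ring
    have h2 : (CFC.sqrt S * X * CFC.sqrt S).trace = (S * X).trace := by
      rw [trace_mul_comm, ← Matrix.mul_assoc, cfcSqrt_mul_cfcSqrt hS]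
    rw [gammaKernel_of_posDef s _ hX, gammaKernel_of_posDef s _ (hiff.2 hX), h1, Matrix.one_mul,
      h2, ← ENNReal.ofReal_mul (Real.rpow_pos_of_pos hS.det_pos _).le,
      Real.mul_rpow hS.det_pos.le hX.det_pos.le, mul_assoc]
  · rw [gammaKernel_of_not_posDef s _ hX, gammaKernel_of_not_posDef s _ (mt hiff.1 hX), mul_zero]

theorem map_congr_cfcSqrt {m : ℕ} {S : Matrix (Fin m) (Fin m) ℝ} (hS : S.PosDef) :
    (symmLebesgue m).map (fun X => CFC.sqrt S * X * CFC.sqrt S) =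
      ENNReal.ofReal (S.det ^ (-(((m : ℝ) + 1) / 2))) • symmLebesgue m := by
  rw [map_congr_symmLebesgue (posDef_cfcSqrt hS), det_cfcSqrt_pow hS,
    Real.rpow_neg hS.det_pos.le]
  push_cast
  rfl

theorem ofReal_det_rpow_mul {m : ℕ} {S : Matrix (Fin m) (Fin m) ℝ} (hS : S.PosDef) (s t : ℝ) :
    ENNReal.ofReal (S.det ^ s) * ENNReal.ofReal (S.det ^ t) = ENNReal.ofReal (S.det ^ (s + t)) := by
  rw [← ENNReal.ofReal_mul (Real.rpow_pos_of_pos hS.det_pos _).le, Real.rpow_add hS.det_pos]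

/-- Substitute X ↦ S^{1/2} X S^{1/2}. No bound on s is needed, since both sides may be infinite. -/
theorem lintegral_gammaKernel {m : ℕ} (s : ℝ) {S : Matrix (Fin m) (Fin m) ℝ} (hS : S.PosDef) :
    ∫⁻ X, gammaKernel s S X ∂symmLebesgue m =
      ENNReal.ofReal (S.det ^ (-s)) * ∫⁻ X, gammaKernel s 1 X ∂symmLebesgue m := by
  have hK (S : Matrix (Fin m) (Fin m) ℝ) : Measurable (gammaKernel s S) :=
    measurable_gammaKernel_comp s measurable_const measurable_id
  have h := lintegral_map (μ := symmLebesgue m) (hK 1)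
    (measurable_congr (CFC.sqrt S) (CFC.sqrt S))
  rw [map_congr_cfcSqrt hS, lintegral_smul_measure] at h
  simp only [gammaKernel_congr_cfcSqrt s hS, smul_eq_mul] at h
  rw [lintegral_const_mul _ (hK S)] at h
  -- The factor is the inverse of the power of |S| in front of the integral of the kernel with
  -- parameter S.
  have h' := congrArg (ENNReal.ofReal (S.det ^ (((m : ℝ) + 1) / 2 - s)) * ·) h
  simp only [← mul_assoc, ofReal_det_rpow_mul hS] at h'
  ring_nf at h'
  simpa using h'.symm

theorem lintegral_prod_congr_cfcSqrt {m : ℕ} {S : Matrix (Fin m) (Fin m) ℝ} (hS : S.PosDef)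
    {g : Matrix (Fin m) (Fin m) ℝ × Matrix (Fin m) (Fin m) ℝ → ℝ≥0∞} (hg : Measurable g) :
    ∫⁻ F, g F ∂((symmLebesgue m).prod (symmLebesgue m)) =
      ENNReal.ofReal (S.det ^ ((m : ℝ) + 1)) *
        ∫⁻ F, g (CFC.sqrt S * F.1 * CFC.sqrt S, CFC.sqrt S * F.2 * CFC.sqrt S)
          ∂((symmLebesgue m).prod (symmLebesgue m)) := by
  have hc := measurable_congr (CFC.sqrt S) (CFC.sqrt S)
  have h := lintegral_map (μ := (symmLebesgue m).prod (symmLebesgue m)) hg (hc.prodMap hc)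
  rw [← Measure.map_prod_map _ _ hc hc, map_congr_cfcSqrt hS, Measure.prod_smul_left,
    Measure.prod_smul_right, lintegral_smul_measure, lintegral_smul_measure] at h
  change _ = ∫⁻ F : Matrix (Fin m) (Fin m) ℝ × Matrix (Fin m) (Fin m) ℝ,
    g (CFC.sqrt S * F.1 * CFC.sqrt S, CFC.sqrt S * F.2 * CFC.sqrt S) ∂_ at h
  rw [← h, smul_eq_mul, smul_eq_mul, ← mul_assoc, ← mul_assoc, ofReal_det_rpow_mul hS,
    ofReal_det_rpow_mul hS]
  ring_nf
  simp

/-- Valid even if the integral diverges: the Bochner integral and `toReal` of ⊤ are then both 0. -/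
theorem multiGamma_eq_toReal (m : ℕ) (a : ℝ) :
    multiGamma m a = (∫⁻ X, gammaKernel a 1 X ∂symmLebesgue m).toReal := by
  have hset := measurableSet_setOf_posDef m
  have hdet : Measurable fun X : Matrix (Fin m) (Fin m) ℝ => X.det :=
    Continuous.measurable (by fun_prop)
  have hexp : Measurable fun X : Matrix (Fin m) (Fin m) ℝ => Real.exp (-X.trace) :=
    Continuous.measurable (by fun_prop)
  rw [multiGamma, integral_eq_lintegral_of_nonneg_ae]
  · rw [← lintegral_indicator hset]
    congr 2
    funext X
    simp only [gammaKernel, Set.indicator, Matrix.one_mul, mul_comm]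
  · filter_upwards [ae_restrict_mem hset] with X hX
    have := (Real.rpow_pos_of_pos (Matrix.PosDef.det_pos hX) (a - ((m : ℝ) + 1) / 2)).le
    simp only [Pi.zero_apply]
    positivity
  · exact (hexp.mul (hdet.pow_const _)).aestronglyMeasurable

theorem multiGamma_nonneg (m : ℕ) (a : ℝ) : 0 ≤ multiGamma m a := by
  rw [multiGamma_eq_toReal]; exact ENNReal.toReal_nonneg

theorem matrixGammaMeasure_one (m : ℕ) (a : ℝ) :
    matrixGammaMeasure m a 1 = (symmLebesgue m).withDensity fun X =>
      ENNReal.ofReal (multiGamma m a)⁻¹ * gammaKernel a 1 X := by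
  rw [matrixGammaMeasure]
  congr 1
  funext X
  by_cases hX : X.PosDef
  · rw [gammaKernel_of_posDef a _ hX, matrixGammaDensity,
      Set.indicator_of_mem (s := {X : Matrix (Fin m) (Fin m) ℝ | X.PosDef}) hX,
      ← ENNReal.ofReal_mul (inv_nonneg.2 (multiGamma_nonneg m a))]
    simp [mul_assoc]
  · rw [gammaKernel_of_not_posDef a _ hX, matrixGammaDensity,
      Set.indicator_of_notMem (s := {X : Matrix (Fin m) (Fin m) ℝ | X.PosDef}) hX]
    simp

theorem gammaKernel_eq_zero_mul {m : ℕ} (s : ℝ) (S X : Matrix (Fin m) (Fin m) ℝ) :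
    gammaKernel s S X = gammaKernel s 0 X * ENNReal.ofReal (Real.exp (-(S * X).trace)) := by
  simpa using gammaKernel_add s 0 S X

/-! ### Integrating out C -/

theorem gammaKernel_mul_gammaKernel_mul_gammaKernel {m : ℕ} (a b c : ℝ)
    (C F G : Matrix (Fin m) (Fin m) ℝ) :
    gammaKernel c 1 C * (ENNReal.ofReal (C.det ^ (a + b)) *
        (gammaKernel a C F * gammaKernel b C G)) =
      gammaKernel a 0 F * gammaKernel b 0 G * gammaKernel (a + b + c) (1 + F + G) C := by
  rw [gammaKernel_eq_zero_mul a C F, gammaKernel_eq_zero_mul b C G, gammaKernel_add _ _ G,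
    gammaKernel_add _ _ F, show a + b + c = c + (a + b) by ring, ← gammaKernel_mul_det_rpow c,
    trace_mul_comm C F, trace_mul_comm C G]
  ring

/-- The two Jacobians contribute |C|^{m+1}, which cancels the shift -(m+1)/2 in both kernels and
leaves |C|^{a+b}. -/
theorem lintegral_symmetrised {m : ℕ} (a b : ℝ) {C : Matrix (Fin m) (Fin m) ℝ} (hC : C.PosDef)
    {h : Matrix (Fin m) (Fin m) ℝ × Matrix (Fin m) (Fin m) ℝ → ℝ≥0∞} (hh : Measurable h) :
    ∫⁻ F, gammaKernel a 1 F.1 * gammaKernel b 1 F.2 *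
        h (invSqrt C * F.1 * invSqrt C, invSqrt C * F.2 * invSqrt C)
        ∂((symmLebesgue m).prod (symmLebesgue m)) =
      ∫⁻ F, ENNReal.ofReal (C.det ^ (a + b)) * (gammaKernel a C F.1 * gammaKernel b C F.2) * h F
        ∂((symmLebesgue m).prod (symmLebesgue m)) := by
  have hK (s : ℝ) (S : Matrix (Fin m) (Fin m) ℝ) : Measurable (gammaKernel s S) :=
    measurable_gammaKernel_comp s measurable_const measurable_id
  have hu : IsUnit (CFC.sqrt C).det := (posDef_cfcSqrt hC).det_pos.ne'.isUnit
  have hcancel (X : Matrix (Fin m) (Fin m) ℝ) :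
      invSqrt C * (CFC.sqrt C * X * CFC.sqrt C) * invSqrt C = X := by
    rw [invSqrt, Matrix.mul_assoc (CFC.sqrt C), nonsing_inv_mul_cancel_left _ _ hu,
      mul_nonsing_inv_cancel_right _ _ hu]
  have hinv := measurable_congr (invSqrt C) (invSqrt C)
  have hcong := measurable_congr (CFC.sqrt C) (CFC.sqrt C)
  rw [lintegral_prod_congr_cfcSqrt hC]
  · rw [← lintegral_const_mul]
    · refine lintegral_congr fun F => ?_
      simp only [hcancel, gammaKernel_congr_cfcSqrt _ hC]
      rw [show a + b = ((m : ℝ) + 1) + ((a - ((m : ℝ) + 1) / 2) + (b - ((m : ℝ) + 1) / 2)) by ring,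
        ← ofReal_det_rpow_mul hC ((m : ℝ) + 1),
        ← ofReal_det_rpow_mul hC (a - ((m : ℝ) + 1) / 2)]
      ring
    · simp only [hcancel]
      exact ((((hK a 1).comp (hcong.comp measurable_fst)).mul
        ((hK b 1).comp (hcong.comp measurable_snd))).mul hh)
  · exact (((hK a 1).comp measurable_fst).mul ((hK b 1).comp measurable_snd)).mul
      (hh.comp ((hinv.comp measurable_fst).prodMk (hinv.comp measurable_snd)))

theorem lintegral_beta_of_gamma {m : ℕ} (a b c : ℝ)
    {h : Matrix (Fin m) (Fin m) ℝ × Matrix (Fin m) (Fin m) ℝ → ℝ≥0∞} (hh : Measurable h) :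
    ∫⁻ C, gammaKernel c 1 C * ∫⁻ F, gammaKernel a 1 F.1 * gammaKernel b 1 F.2 *
        h (invSqrt C * F.1 * invSqrt C, invSqrt C * F.2 * invSqrt C)
        ∂((symmLebesgue m).prod (symmLebesgue m)) ∂symmLebesgue m =
      (∫⁻ C, gammaKernel (a + b + c) 1 C ∂symmLebesgue m) *
        ∫⁻ F, gammaKernel a 0 F.1 * gammaKernel b 0 F.2 *
          ENNReal.ofReal ((1 + F.1 + F.2).det ^ (-(a + b + c))) * h F
          ∂((symmLebesgue m).prod (symmLebesgue m)) := by
  have hK (s : ℝ) (S : Matrix (Fin m) (Fin m) ℝ) : Measurable (gammaKernel s S) :=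
    measurable_gammaKernel_comp s measurable_const measurable_id
  have hW : Measurable fun F : Matrix (Fin m) (Fin m) ℝ × Matrix (Fin m) (Fin m) ℝ =>
      gammaKernel a 0 F.1 * gammaKernel b 0 F.2 :=
    ((hK a 0).comp measurable_fst).mul ((hK b 0).comp measurable_snd)
  have hsum : Measurable fun F : Matrix (Fin m) (Fin m) ℝ × Matrix (Fin m) (Fin m) ℝ =>
      1 + F.1 + F.2 := Continuous.measurable (by fun_prop)
  have hdet : Measurable fun F : Matrix (Fin m) (Fin m) ℝ × Matrix (Fin m) (Fin m) ℝ =>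
      ENNReal.ofReal ((1 + F.1 + F.2).det ^ (-(a + b + c))) :=
    ((Continuous.measurable (by fun_prop)).pow_const _).ennreal_ofReal
  have hinner (C : Matrix (Fin m) (Fin m) ℝ) :
      gammaKernel c 1 C * ∫⁻ F, gammaKernel a 1 F.1 * gammaKernel b 1 F.2 *
        h (invSqrt C * F.1 * invSqrt C, invSqrt C * F.2 * invSqrt C)
        ∂((symmLebesgue m).prod (symmLebesgue m)) =
      ∫⁻ F, gammaKernel a 0 F.1 * gammaKernel b 0 F.2 * h F *
        gammaKernel (a + b + c) (1 + F.1 + F.2) C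
        ∂((symmLebesgue m).prod (symmLebesgue m)) := by
    by_cases hC : C.PosDef
    · rw [lintegral_symmetrised a b hC hh, ← lintegral_const_mul]
      · refine lintegral_congr fun F => ?_
        rw [← mul_assoc, gammaKernel_mul_gammaKernel_mul_gammaKernel a b c]
        ring
      · exact (measurable_const.mul (((hK a C).comp measurable_fst).mul
          ((hK b C).comp measurable_snd))).mul hh
    · simp [gammaKernel_of_not_posDef _ _ hC]
  simp only [hinner]
  rw [lintegral_lintegral_swap, ← lintegral_const_mul]
  · refine lintegral_congr fun F => ?_
    rw [lintegral_const_mul _ (hK _ _)]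
    -- The scaling law needs I + F₁ + F₂ > 0; where F₁ or F₂ leaves the cone, the weight vanishes
    -- instead.
    by_cases hF : F.1.PosDef ∧ F.2.PosDef
    · rw [lintegral_gammaKernel _ ((PosDef.one.add hF.1).add hF.2)]
      ring
    · have : gammaKernel a 0 F.1 * gammaKernel b 0 F.2 = 0 := by
        rcases not_and_or.1 hF with h1 | h1 <;> simp [gammaKernel_of_not_posDef _ _ h1]
      simp [this]
  · exact (hW.mul hdet).mul hh
  · exact (((hW.mul hh).comp measurable_snd).mul
      (measurable_gammaKernel_comp _ (hsum.comp measurable_snd) measurable_fst)).aemeasurable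

/-! ### The density and the law of the ratio -/

theorem ofReal_bimatrixBetaIIDensity {m : ℕ} (a b c : ℝ)
    (F : Matrix (Fin m) (Fin m) ℝ × Matrix (Fin m) (Fin m) ℝ) :
    ENNReal.ofReal (bimatrixBetaIIDensity m a b c F) =
      ENNReal.ofReal (multiBetaStar m a b c)⁻¹ *
        (gammaKernel a 0 F.1 * gammaKernel b 0 F.2 *
          ENNReal.ofReal ((1 + F.1 + F.2).det ^ (-(a + b + c)))) := by
  by_cases hF : F.1.PosDef ∧ F.2.PosDef
  · have h1 := (Real.rpow_pos_of_pos hF.1.det_pos (a - ((m : ℝ) + 1) / 2)).le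
    have h2 := (Real.rpow_pos_of_pos hF.2.det_pos (b - ((m : ℝ) + 1) / 2)).le
    have hS := ((PosDef.one.add hF.1).add hF.2).det_pos
    have h3 : 0 ≤ (multiBetaStar m a b c)⁻¹ := inv_nonneg.2 (div_nonneg (mul_nonneg (mul_nonneg
      (multiGamma_nonneg m a) (multiGamma_nonneg m b)) (multiGamma_nonneg m c))
      (multiGamma_nonneg m _))
    rw [bimatrixBetaIIDensity, Set.indicator_of_mem (s := {F : Matrix (Fin m) (Fin m) ℝ ×
      Matrix (Fin m) (Fin m) ℝ | F.1.PosDef ∧ F.2.PosDef}) hF, gammaKernel_of_posDef a _ hF.1,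
      gammaKernel_of_posDef b _ hF.2, ← ENNReal.ofReal_mul (by positivity),
      ← ENNReal.ofReal_mul (by positivity), ← ENNReal.ofReal_mul h3, Real.rpow_neg hS.le]
    congr 1
    simp only [Matrix.zero_mul, trace_zero, neg_zero, Real.exp_zero, mul_one]
    rw [div_eq_mul_inv, mul_inv]
    ring
  · have : gammaKernel a 0 F.1 * gammaKernel b 0 F.2 = 0 := by
      rcases not_and_or.1 hF with h1 | h1 <;> simp [gammaKernel_of_not_posDef _ _ h1]
    rw [bimatrixBetaIIDensity, Set.indicator_of_notMem (s := {F : Matrix (Fin m) (Fin m) ℝ ×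
      Matrix (Fin m) (Fin m) ℝ | F.1.PosDef ∧ F.2.PosDef}) hF, this]
    simp

/-- `((A, B), C) ↦ (C^{-1/2} A C^{-1/2}, C^{-1/2} B C^{-1/2})`. -/
noncomputable def bimatrixRatio {m : ℕ}
    (p : (Matrix (Fin m) (Fin m) ℝ × Matrix (Fin m) (Fin m) ℝ) × Matrix (Fin m) (Fin m) ℝ) :
    Matrix (Fin m) (Fin m) ℝ × Matrix (Fin m) (Fin m) ℝ :=
  (invSqrt p.2 * p.1.1 * invSqrt p.2, invSqrt p.2 * p.1.2 * invSqrt p.2)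

theorem measurable_bimatrixRatio (m : ℕ) : Measurable (bimatrixRatio (m := m)) := by
  have hmul : Measurable fun q : Matrix (Fin m) (Fin m) ℝ × Matrix (Fin m) (Fin m) ℝ =>
      q.1 * q.2 * q.1 := Continuous.measurable (by fun_prop)
  have hinv : Measurable fun p : (Matrix (Fin m) (Fin m) ℝ × Matrix (Fin m) (Fin m) ℝ) ×
      Matrix (Fin m) (Fin m) ℝ => invSqrt p.2 := (measurable_invSqrt m).comp measurable_snd
  have hA : Measurable fun p : (Matrix (Fin m) (Fin m) ℝ × Matrix (Fin m) (Fin m) ℝ) ×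
      Matrix (Fin m) (Fin m) ℝ => p.1.1 := measurable_fst.fst
  have hB : Measurable fun p : (Matrix (Fin m) (Fin m) ℝ × Matrix (Fin m) (Fin m) ℝ) ×
      Matrix (Fin m) (Fin m) ℝ => p.1.2 := measurable_fst.snd
  have h1 := hmul.comp (hinv.prodMk hA)
  have h2 := hmul.comp (hinv.prodMk hB)
  exact h1.prodMk h2

theorem lintegral_bimatrixRatio (m : ℕ) (a b c : ℝ)
    {h : Matrix (Fin m) (Fin m) ℝ × Matrix (Fin m) (Fin m) ℝ → ℝ≥0∞} (hh : Measurable h) :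
    ∫⁻ p, h (bimatrixRatio p)
        ∂(((matrixGammaMeasure m a 1).prod (matrixGammaMeasure m b 1)).prod
          (matrixGammaMeasure m c 1)) =
      ENNReal.ofReal ((multiGamma m a)⁻¹ * (multiGamma m b)⁻¹ * (multiGamma m c)⁻¹) *
        (∫⁻ C, gammaKernel (a + b + c) 1 C ∂symmLebesgue m) *
        ∫⁻ F, gammaKernel a 0 F.1 * gammaKernel b 0 F.2 *
          ENNReal.ofReal ((1 + F.1 + F.2).det ^ (-(a + b + c))) * h F
          ∂((symmLebesgue m).prod (symmLebesgue m)) := by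
  have hK (s : ℝ) (S : Matrix (Fin m) (Fin m) ℝ) : Measurable (gammaKernel s S) :=
    measurable_gammaKernel_comp s measurable_const measurable_id
  have hd (s : ℝ) : Measurable fun X : Matrix (Fin m) (Fin m) ℝ =>
      ENNReal.ofReal (multiGamma m s)⁻¹ * gammaKernel s 1 X := measurable_const.mul (hK s 1)
  have hab : Measurable fun F : Matrix (Fin m) (Fin m) ℝ × Matrix (Fin m) (Fin m) ℝ =>
      ENNReal.ofReal (multiGamma m a)⁻¹ * gammaKernel a 1 F.1 *
        (ENNReal.ofReal (multiGamma m b)⁻¹ * gammaKernel b 1 F.2) :=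
    ((hd a).comp measurable_fst).mul ((hd b).comp measurable_snd)
  have habc : Measurable fun p : (Matrix (Fin m) (Fin m) ℝ × Matrix (Fin m) (Fin m) ℝ) ×
      Matrix (Fin m) (Fin m) ℝ =>
      ENNReal.ofReal (multiGamma m a)⁻¹ * gammaKernel a 1 p.1.1 *
        (ENNReal.ofReal (multiGamma m b)⁻¹ * gammaKernel b 1 p.1.2) *
        (ENNReal.ofReal (multiGamma m c)⁻¹ * gammaKernel c 1 p.2) :=
    (hab.comp measurable_fst).mul ((hd c).comp measurable_snd)
  have hK1 : Measurable fun F : Matrix (Fin m) (Fin m) ℝ × Matrix (Fin m) (Fin m) ℝ =>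
      gammaKernel a 1 F.1 * gammaKernel b 1 F.2 :=
    ((hK a 1).comp measurable_fst).mul ((hK b 1).comp measurable_snd)
  have hΦ : Measurable fun p : (Matrix (Fin m) (Fin m) ℝ × Matrix (Fin m) (Fin m) ℝ) ×
      Matrix (Fin m) (Fin m) ℝ => h (bimatrixRatio p) := hh.comp (measurable_bimatrixRatio m)
  have hint : Measurable fun p : (Matrix (Fin m) (Fin m) ℝ × Matrix (Fin m) (Fin m) ℝ) ×
      Matrix (Fin m) (Fin m) ℝ =>
      gammaKernel a 1 p.1.1 * gammaKernel b 1 p.1.2 * h (bimatrixRatio p) := by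
    have hK2 : Measurable fun p : (Matrix (Fin m) (Fin m) ℝ × Matrix (Fin m) (Fin m) ℝ) ×
        Matrix (Fin m) (Fin m) ℝ => gammaKernel a 1 p.1.1 * gammaKernel b 1 p.1.2 :=
      hK1.comp measurable_fst
    exact hK2.mul hΦ
  have hin : Measurable fun C : Matrix (Fin m) (Fin m) ℝ =>
      ∫⁻ F, gammaKernel a 1 F.1 * gammaKernel b 1 F.2 *
        h (invSqrt C * F.1 * invSqrt C, invSqrt C * F.2 * invSqrt C)
        ∂((symmLebesgue m).prod (symmLebesgue m)) := hint.lintegral_prod_left'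
  have ha := inv_nonneg.2 (multiGamma_nonneg m a)
  have hb := inv_nonneg.2 (multiGamma_nonneg m b)
  rw [matrixGammaMeasure_one, matrixGammaMeasure_one, matrixGammaMeasure_one,
    prod_withDensity (hd a) (hd b),
    prod_withDensity hab (hd c), lintegral_withDensity_eq_lintegral_mul _ habc hΦ,
    lintegral_prod_symm' _ (habc.mul hΦ), mul_assoc,
    ← lintegral_beta_of_gamma a b c hh, ← lintegral_const_mul]
  · refine lintegral_congr fun C => ?_
    rw [← mul_assoc, ← lintegral_const_mul]
    · refine lintegral_congr fun F => ?_
      rw [ENNReal.ofReal_mul (mul_nonneg ha hb), ENNReal.ofReal_mul ha]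
      simp only [Pi.mul_apply, bimatrixRatio]
      ring
    · have hΦC := hΦ.comp (measurable_prodMk_right (y := C))
      exact hK1.mul hΦC
  · exact (hK c 1).mul hin

/-- The law of `(C^{-1/2} A C^{-1/2}, C^{-1/2} B C^{-1/2})`. That the gamma laws have total mass one
forces `Γ_m[a + b + c]` to be finite. -/
theorem map_bimatrixRatio (m : ℕ) (a b c : ℝ)
    [IsProbabilityMeasure (matrixGammaMeasure m a 1)]
    [IsProbabilityMeasure (matrixGammaMeasure m b 1)]
    [IsProbabilityMeasure (matrixGammaMeasure m c 1)] :
    (((matrixGammaMeasure m a 1).prod (matrixGammaMeasure m b 1)).prod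
        (matrixGammaMeasure m c 1)).map bimatrixRatio =
      ((symmLebesgue m).prod (symmLebesgue m)).withDensity
        fun F => ENNReal.ofReal (bimatrixBetaIIDensity m a b c F) := by
  have hK (s : ℝ) (S : Matrix (Fin m) (Fin m) ℝ) : Measurable (gammaKernel s S) :=
    measurable_gammaKernel_comp s measurable_const measurable_id
  have hJ : (∫⁻ C, gammaKernel (a + b + c) 1 C ∂symmLebesgue m) ≠ ⊤ := by
    -- With h = 1 the left side is the total mass 1, while an infinite factor would make the right
    -- side 0 or ⊤.
    intro hJ
    have h := lintegral_bimatrixRatio m a b c (h := fun _ => 1) measurable_const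
    rw [hJ, lintegral_one, measure_univ, mul_right_comm] at h
    rcases eq_or_ne (ENNReal.ofReal ((multiGamma m a)⁻¹ * (multiGamma m b)⁻¹ *
      (multiGamma m c)⁻¹) * ∫⁻ F, gammaKernel a 0 F.1 * gammaKernel b 0 F.2 *
          ENNReal.ofReal ((1 + F.1 + F.2).det ^ (-(a + b + c))) * 1
          ∂((symmLebesgue m).prod (symmLebesgue m))) 0 with h0 | h0
    · rw [h0, zero_mul] at h; exact one_ne_zero h
    · rw [ENNReal.mul_top h0] at h; exact ENNReal.one_ne_top h
  have hconst : ENNReal.ofReal ((multiGamma m a)⁻¹ * (multiGamma m b)⁻¹ * (multiGamma m c)⁻¹) *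
      (∫⁻ C, gammaKernel (a + b + c) 1 C ∂symmLebesgue m) =
      ENNReal.ofReal (multiBetaStar m a b c)⁻¹ := by
    have h1 := inv_nonneg.2 (multiGamma_nonneg m a)
    have h2 := inv_nonneg.2 (multiGamma_nonneg m b)
    have h3 := inv_nonneg.2 (multiGamma_nonneg m c)
    rw [← ENNReal.ofReal_toReal hJ, ← multiGamma_eq_toReal, ← ENNReal.ofReal_mul (by positivity),
      multiBetaStar, inv_div, div_eq_mul_inv, mul_inv, mul_inv, mul_comm]
  have hdet : Measurable fun F : Matrix (Fin m) (Fin m) ℝ × Matrix (Fin m) (Fin m) ℝ =>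
      ENNReal.ofReal ((1 + F.1 + F.2).det ^ (-(a + b + c))) :=
    ((Continuous.measurable (by fun_prop)).pow_const _).ennreal_ofReal
  have hW : Measurable fun F : Matrix (Fin m) (Fin m) ℝ × Matrix (Fin m) (Fin m) ℝ =>
      gammaKernel a 0 F.1 * gammaKernel b 0 F.2 *
        ENNReal.ofReal ((1 + F.1 + F.2).det ^ (-(a + b + c))) :=
    (((hK a 0).comp measurable_fst).mul ((hK b 0).comp measurable_snd)).mul hdet
  refine Measure.ext_of_lintegral _ fun h hh => ?_
  simp only [ofReal_bimatrixBetaIIDensity]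
  rw [lintegral_map hh (measurable_bimatrixRatio m), lintegral_bimatrixRatio m a b c hh, hconst,
    lintegral_withDensity_eq_lintegral_mul _ (hW.const_mul _) hh, ← lintegral_const_mul]
  · refine lintegral_congr fun F => ?_
    simp only [Pi.mul_apply]
    ring
  · exact hW.mul hh

theorem mainTheorem2 {Ω : Type*} [MeasurableSpace Ω] (P : MeasureTheory.Measure Ω)
    [MeasureTheory.IsProbabilityMeasure P] (m : ℕ) (hm : 1 ≤ m) (a b c : ℝ)
    (ha : ((m : ℝ) - 1) / 2 < a) (hb : ((m : ℝ) - 1) / 2 < b) (hc : ((m : ℝ) - 1) / 2 < c)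
    (A B C : Ω → Matrix (Fin m) (Fin m) ℝ)
    (hA : ProbabilityTheory.HasLaw A (matrixGammaMeasure m a 1) P)
    (hB : ProbabilityTheory.HasLaw B (matrixGammaMeasure m b 1) P)
    (hC : ProbabilityTheory.HasLaw C (matrixGammaMeasure m c 1) P)
    (hindep : ProbabilityTheory.iIndepFun ![A, B, C] P) :
    ProbabilityTheory.HasLaw
      (fun ω => (invSqrt (C ω) * A ω * invSqrt (C ω), invSqrt (C ω) * B ω * invSqrt (C ω)))
      (((symmLebesgue m).prod (symmLebesgue m)).withDensity
        fun F => ENNReal.ofReal (bimatrixBetaIIDensity m a b c F)) P := by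

  -- The gamma measures inherit total mass one from P, so no gamma integral has to be evaluated.
  have hpa : IsProbabilityMeasure (matrixGammaMeasure m a 1) :=
    hA.isProbabilityMeasure_iff.1 inferInstance
  have hpb : IsProbabilityMeasure (matrixGammaMeasure m b 1) :=
    hB.isProbabilityMeasure_iff.1 inferInstance
  have hpc : IsProbabilityMeasure (matrixGammaMeasure m c 1) :=
    hC.isProbabilityMeasure_iff.1 inferInstance
  have hAB : ProbabilityTheory.IndepFun A B P :=
    hindep.indepFun (i := 0) (j := 1) (by decide)
  have hmeas : ∀ i, AEMeasurable ((![A, B, C] : Fin 3 → Ω → Matrix (Fin m) (Fin m) ℝ) i) P := by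
    intro i
    fin_cases i
    exacts [hA.aemeasurable, hB.aemeasurable, hC.aemeasurable]
  have hABC : ProbabilityTheory.IndepFun (fun ω => (A ω, B ω)) C P :=
    hindep.indepFun_prodMk₀ hmeas 0 1 2 (by decide) (by decide)
  have hABm := hA.aemeasurable.prodMk hB.aemeasurable
  have hlaw : P.map (fun ω => ((A ω, B ω), C ω)) =
      ((matrixGammaMeasure m a 1).prod (matrixGammaMeasure m b 1)).prod
        (matrixGammaMeasure m c 1) := by
    rw [hABC.map_prod_eq_prod_map_map hABm hC.aemeasurable,
      hAB.map_prod_eq_prod_map_map hA.aemeasurable hB.aemeasurable, hA.map_eq, hB.map_eq,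
      hC.map_eq]
  have hm3 := hABm.prodMk hC.aemeasurable
  have hmap : P.map (bimatrixRatio ∘ fun ω => ((A ω, B ω), C ω)) =
      ((symmLebesgue m).prod (symmLebesgue m)).withDensity
        fun F => ENNReal.ofReal (bimatrixBetaIIDensity m a b c F) := by
    rw [← map_bimatrixRatio m a b c, ← hlaw,
      AEMeasurable.map_map_of_aemeasurable (measurable_bimatrixRatio m).aemeasurable hm3]
  have hmeas' := (measurable_bimatrixRatio m).comp_aemeasurable hm3
  exact ⟨hmeas', hmap⟩
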